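/- Let $\mathbb{K}$ be an algebraically closed field of characteristic $0$. All varieties are irreducible; a subvariety of $\mathbb{P}^n=\mathbb{P}^n_{\mathbb K}$ is an irreducible Zariski closed subset. For a subvariety $X\subseteq\mathbb{P}^n$ let $I(X)$ be its homogeneous vanishing ideal, and let $HF_X(m)=\dim_{\mathbb K}\big(\mathbb{K}[x_0,\dots,x_n]/I(X)\big)_m$ be the Hilbert function of its homogeneous coordinate ring. The dimension of $X$ is its Krull dimension in the Zariski topology, and its degree is $r!$ times the leading coefficient of its Hilbert polynomial, where $r$ is the degree of that polynomial. The Hadamard product $X_1\odot\cdots\odot X_\ell\subseteq\mathbb{P}^n$ is the Zariski closure of the set of all coordinatewise products $P_1\odot\cdots\odot P_\ell$ of points $P_i\in X_i$, taken whenever the coordinatewise product is not the zero vector. Let $\ell\ge 1$, $n\ge 0$ and $h_1,\dots,h_\ell\ge 0$ be integers with $n\ge (h_1+1)\cdots(h_\ell+1)-1$, and let $L_1,\dots,L_\ell$ be generic linear subspaces of $\mathbb{P}^n$ of dimensions $h_1,\dots,h_\ell$; that is, $(L_1,\dots,L_\ell)$ is any element of a suitable non-empty Zariski open subset, depending only on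 $\mathbb K,n,h_1,\dots,h_\ell$, of the product of the Grassmannians of $h_i$-dimensional linear subspaces of $\mathbb{P}^n$. For each $i=1,\dots,\ell$ let $X_i$ be a subvariety of $\mathbb{P}^n$ contained in $L_i$, of dimension $r_i$ and degree $d_i$. Then (i) $\dim(X_1\odot\cdots\odot X_\ell)=r_1+\cdots+r_\ell$; (ii) $\deg(X_1\odot\cdots\odot X_\ell)=\dfrac{(r_1+\cdots+r_\ell)!}{r_1!\cdots r_\ell!}\,\prod_{i=1}^{\ell} d_i$; (iii) $HF_{X_1\odot\cdots\odot X_\ell}(m)=\prod_{i=1}^{\ell}HF_{X_i}(m)$ for all integers $m\ge 0$. -/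

import Mathlib

namespace HadamardVarieties

open MvPolynomial

/-- The projective space of dimension `n` over `K`, as the set of lines in `K^(n+1)`. -/
abbrev PP (K : Type*) [Field K] (n : ℕ) : Type _ := Projectivization K (Fin (n + 1) → K)

/-- The common zeros of the polynomials in `S`. It is used for sets `S` of homogeneous polynomials,
for which the choice of representatives of the points does not matter. -/
def zeroLocus {K : Type*} [Field K] {n : ℕ} (S : Set (MvPolynomial (Fin (n + 1)) K)) :
    Set (PP K n) :=
  {p | ∀ f ∈ S, eval p.rep f = 0}

/-- A set of polynomials all of whose members are homogeneous (of possibly different degrees). -/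
def HomogeneousSet {K : Type*} [Field K] {n : ℕ} (S : Set (MvPolynomial (Fin (n + 1)) K)) : Prop :=
  ∀ f ∈ S, ∃ d : ℕ, f.IsHomogeneous d

/-- The Zariski topology on projective space: the closed sets are the zero loci of sets of
homogeneous polynomials. -/
instance zariskiTopology (K : Type*) [Field K] (n : ℕ) : TopologicalSpace (PP K n) :=
  TopologicalSpace.ofClosed {Z | ∃ S, HomogeneousSet S ∧ Z = zeroLocus S}
    (by
      refine ⟨{1}, ?_, ?_⟩
      · rintro f rfl
        exact ⟨0, isHomogeneous_one _ _⟩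
      · ext p
        simp [zeroLocus])
    (by
      intro A hA
      have hA' : ∀ Z ∈ A, ∃ S : Set (MvPolynomial (Fin (n + 1)) K),
          HomogeneousSet S ∧ Z = zeroLocus S := fun Z hZA => hA hZA
      choose! S hS hZ using hA'
      refine ⟨⋃ Z ∈ A, S Z, ?_, ?_⟩
      · intro f hf
        simp only [Set.mem_iUnion] at hf
        obtain ⟨Z, hZA, hfZ⟩ := hf
        exact hS Z hZA f hfZ
      · ext p
        simp only [Set.mem_sInter, zeroLocus, Set.mem_iUnion, Set.mem_ofPred_eq]
        constructor
        · rintro h f ⟨Z, hZA, hfZ⟩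
          have hp := h Z hZA
          rw [hZ Z hZA] at hp
          exact hp f hfZ
        · intro h Z hZA
          rw [hZ Z hZA]
          exact fun f hf => h f ⟨Z, hZA, hf⟩)
    (by
      rintro _ ⟨S, hS, rfl⟩ _ ⟨T, hT, rfl⟩
      refine ⟨{h | ∃ f ∈ S, ∃ g ∈ T, h = f * g}, ?_, ?_⟩
      · rintro _ ⟨f, hf, g, hg, rfl⟩
        obtain ⟨a, ha⟩ := hS f hf
        obtain ⟨b, hb⟩ := hT g hg
        exact ⟨a + b, ha.mul hb⟩
      · ext p
        simp only [Set.mem_union, zeroLocus, Set.mem_ofPred_eq]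
        constructor
        · rintro (h | h) _ ⟨f, hf, g, hg, rfl⟩
          · simp [h f hf]
          · simp [h g hg]
        · intro h
          by_contra hcon
          push Not at hcon
          obtain ⟨⟨f, hf, hf0⟩, g, hg, hg0⟩ := hcon
          have := h _ ⟨f, hf, g, hg, rfl⟩
          rw [map_mul] at this
          exact (mul_ne_zero hf0 hg0) this)

/-- A (projective) subvariety of projective space: a Zariski closed irreducible subset
(in particular it is non-empty). -/
def IsSubvariety {K : Type*} [Field K] {n : ℕ} (X : Set (PP K n)) : Prop :=
  IsClosed X ∧ IsIrreducible X

/-- The homogeneous vanishing ideal `I(X)`, generated by all homogeneous polynomials vanishing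
at every point of `X`. -/
noncomputable def vanishingIdeal {K : Type*} [Field K] {n : ℕ} (X : Set (PP K n)) :
    Ideal (MvPolynomial (Fin (n + 1)) K) :=
  Ideal.span {f | (∃ d : ℕ, f.IsHomogeneous d) ∧ ∀ p ∈ X, eval p.rep f = 0}

/-- The homogeneous coordinate ring `K[x_0, …, x_n] / I(X)`. -/
abbrev CoordinateRing {K : Type*} [Field K] {n : ℕ} (X : Set (PP K n)) : Type _ :=
  MvPolynomial (Fin (n + 1)) K ⧸ vanishingIdeal X

/-- The degree `m` part of the homogeneous coordinate ring: the classes of the homogeneous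
polynomials of degree `m`. -/
noncomputable def coordinateRingPart {K : Type*} [Field K] {n : ℕ} (X : Set (PP K n)) (m : ℕ) :
    Submodule K (CoordinateRing X) :=
  (homogeneousSubmodule (Fin (n + 1)) K m).map
    (Ideal.Quotient.mkₐ K (vanishingIdeal X)).toLinearMap

/-- The Hilbert function `HF_X` of (the homogeneous coordinate ring of) `X`. -/
noncomputable def hilbertFunction {K : Type*} [Field K] {n : ℕ} (X : Set (PP K n)) (m : ℕ) : ℕ :=
  Module.finrank K (coordinateRingPart X m)

open Classical in
/-- The Hilbert polynomial of `X`: the (unique) polynomial with rational coefficients which agrees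
with the Hilbert function in all large degrees. -/
noncomputable def hilbertPolynomial {K : Type*} [Field K] {n : ℕ} (X : Set (PP K n)) :
    Polynomial ℚ :=
  if h : ∃ P : Polynomial ℚ, ∃ m₀ : ℕ, ∀ m ≥ m₀, P.eval (m : ℚ) = (hilbertFunction X m : ℚ)
  then h.choose else 0

/-- The degree of `X`: if the Hilbert polynomial has degree `r`, its leading coefficient
times `r!`. -/
noncomputable def degree {K : Type*} [Field K] {n : ℕ} (X : Set (PP K n)) : ℚ :=
  (hilbertPolynomial X).leadingCoeff * ((hilbertPolynomial X).natDegree.factorial : ℚ)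

/-- The dimension of `X`, as a topological space with the Zariski topology. -/
noncomputable def dim {K : Type*} [Field K] {n : ℕ} (X : Set (PP K n)) : WithBot ℕ∞ :=
  topologicalKrullDim X

/-- The Hadamard product `X_1 ⊙ ⋯ ⊙ X_ℓ`: the Zariski closure of the set of all coordinatewise
products of points `P_i ∈ X_i`, whenever such a product is defined (i.e. is not the zero vector). -/
def hadamardProduct {K : Type*} [Field K] {n ℓ : ℕ} (X : Fin ℓ → Set (PP K n)) : Set (PP K n) :=
  closure {Q | ∃ P : Fin ℓ → PP K n, (∀ i, P i ∈ X i) ∧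
    ∃ hne : (fun j => ∏ i, (P i).rep j) ≠ 0,
      Q = Projectivization.mk K (fun j => ∏ i, (P i).rep j) hne}

/-- Tuples `(L_1, …, L_ℓ)` of linear subspaces of `ℙ^n` of projective dimensions `h_1, …, h_ℓ`,
i.e. points of a product of Grassmannians. A linear subspace of projective dimension `h` is given
by the corresponding vector subspace of dimension `h + 1`. -/
def LinearSubspaces (K : Type*) [Field K] (n : ℕ) {ℓ : ℕ} (h : Fin ℓ → ℕ) : Type _ :=
  ∀ i, {W : Submodule K (Fin (n + 1) → K) // Module.finrank K W = h i + 1}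

/-- The linear subspace of `ℙ^n` determined by the `i`-th member of the tuple. -/
def LinearSubspaces.toSet {K : Type*} [Field K] {n ℓ : ℕ} {h : Fin ℓ → ℕ}
    (L : LinearSubspaces K n h) (i : Fin ℓ) : Set (PP K n) :=
  {p | p.submodule ≤ (L i).1}

/-- `A` is a parameterization of `L`: for each `i` the vectors `A i 0, …, A i (h i)` are a basis of
the vector subspace of `K^(n+1)` corresponding to `L i`. -/
def IsParameterization {K : Type*} [Field K] {n ℓ : ℕ} {h : Fin ℓ → ℕ}
    (A : ∀ i, Fin (h i + 1) → Fin (n + 1) → K) (L : LinearSubspaces K n h) : Prop :=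
  ∀ i, LinearIndependent K (A i) ∧ Submodule.span K (Set.range (A i)) = (L i).1

/-- Zariski open subsets of the product of Grassmannians, with its description as a quotient of the
space of parameterizations: `U` is open if the parameterizations of the members of `U` are the
complement, among all parameterizations, of the zero set of some polynomials in the entries of the
parameterizations. -/
def IsZariskiOpen {K : Type*} [Field K] {n ℓ : ℕ} {h : Fin ℓ → ℕ}
    (U : Set (LinearSubspaces K n h)) : Prop :=
  ∃ S : Set (MvPolynomial (Σ i : Fin ℓ, Fin (h i + 1) × Fin (n + 1)) K),
    ∀ (L : LinearSubspaces K n h) (A : ∀ i, Fin (h i + 1) → Fin (n + 1) → K),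
      IsParameterization A L →
        (L ∈ U ↔ ∃ f ∈ S, eval (fun q => A q.1 q.2.1 q.2.2) f ≠ 0)

/-- A property holds for generic linear subspaces `L_1, …, L_ℓ` of `ℙ^n` of dimensions
`h_1, …, h_ℓ` if it holds for all members of a non-empty Zariski open set of such tuples
(which is dense, products of Grassmannians being irreducible). -/
def ForGenericSubspaces {K : Type*} [Field K] {n ℓ : ℕ} {h : Fin ℓ → ℕ}
    (p : LinearSubspaces K n h → Prop) : Prop :=
  ∃ U : Set (LinearSubspaces K n h), IsZariskiOpen U ∧ U.Nonempty ∧ ∀ L ∈ U, p L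

end HadamardVarieties

/-! Choose bases of the `L i`. On the product of the `L i`, coordinatewise multiplication is the
Segre map followed by the linear map that sends a Segre basis vector to the coordinatewise product
of the corresponding basis vectors. The bound on `n` allows this linear map to be injective.
Injectivity is the non-vanishing of some maximal minor, hence an open condition
(`isZariskiOpen_independentSubspaces`), and it holds for one explicit tuple
(`nonempty_independentSubspaces`). For such `L` the Hadamard product is, up to a linear embedding,
the Segre product of the `X i`.

Statement (iii) is proved with spaces of functions. The degree `m` part of a coordinate ring is the
`m`-th power of the span of the coordinate functions on points (`hilbertFunction_eq_finrank`). By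
injectivity, the coordinate span on tuples of points is the product of the pulled back coordinate
spans (`coordinateSpan_prod`), and the dimension of a product of spaces pulled back from different
factors is the product of their dimensions (`finrank_prod_map_pullback`).

Hence Hilbert polynomials multiply, so their degrees add and their leading coefficients multiply,
which gives (i) and (ii) once the Hilbert polynomial is known to exist and to have the Krull
dimension as its degree. That is `exists_isHilbertPolynomial`, proved by Noetherian induction on
homogeneous ideals: a non-prime ideal is split into a sum and a colon ideal, and a prime one is
compared with its hypersurface sections. -/

namespace HadamardVarieties

open Filter

attribute [local instance] MvPolynomial.gradedAlgebra

/-! ### Hilbert functions of quotients by homogeneous ideals. -/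

section GradedQuotients

open MvPolynomial

variable {K : Type*} [Field K] {n : ℕ}

instance finite_homogeneousSubmodule (m : ℕ) :
    Module.Finite K (homogeneousSubmodule (Fin n) K m) := by
  rw [Module.Finite.iff_fg, ← homogeneousSubmodule_one_pow]
  refine Submodule.FG.pow ?_ m
  rw [homogeneousSubmodule_one_eq_span_X]
  exact Submodule.fg_span (Set.finite_range _)

/-- The classes of the homogeneous polynomials of degree `m` in the quotient by `I`. -/
noncomputable def quotientPart (I : Ideal (MvPolynomial (Fin n) K)) (m : ℕ) :
    Submodule K (MvPolynomial (Fin n) K ⧸ I) :=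
  (homogeneousSubmodule (Fin n) K m).map (Ideal.Quotient.mkₐ K I).toLinearMap

instance finite_quotientPart (I : Ideal (MvPolynomial (Fin n) K)) (m : ℕ) :
    Module.Finite K (quotientPart I m) :=
  Module.Finite.map _ _

/-- The Hilbert function of the quotient by a homogeneous ideal. -/
noncomputable def idealHilbertFunction (I : Ideal (MvPolynomial (Fin n) K)) (m : ℕ) : ℕ :=
  Module.finrank K (quotientPart I m)

lemma mem_quotientPart {I : Ideal (MvPolynomial (Fin n) K)} {m : ℕ}
    {x : MvPolynomial (Fin n) K ⧸ I} :
    x ∈ quotientPart I m ↔ ∃ g : MvPolynomial (Fin n) K, g.IsHomogeneous m ∧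
      Ideal.Quotient.mk I g = x := Iff.rfl

/-- Comparing components of degree `m + e` replaces an arbitrary cofactor of `f` by its component of
degree `m`. -/
lemma exists_homogeneous_of_mem_sup_span {I : Ideal (MvPolynomial (Fin n) K)}
    (hI : I.IsHomogeneous (homogeneousSubmodule (Fin n) K)) {f g : MvPolynomial (Fin n) K}
    {e m : ℕ} (hf : f.IsHomogeneous e) (hg : g.IsHomogeneous (m + e))
    (h : g ∈ I ⊔ Ideal.span {f}) :
    ∃ b : MvPolynomial (Fin n) K, b.IsHomogeneous m ∧ g - b * f ∈ I := by
  obtain ⟨a, ha, c, hc, rfl⟩ := Submodule.mem_sup.1 h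
  obtain ⟨b, rfl⟩ := Ideal.mem_span_singleton'.1 hc
  refine ⟨homogeneousComponent m b, homogeneousComponent_isHomogeneous _ _, ?_⟩
  have h1 : homogeneousComponent (m + e) (a + b * f) = a + b * f := homogeneousComponent_eq_self hg
  have h2 : homogeneousComponent (m + e) (b * f) = homogeneousComponent m b * f :=
    ((decomposition.decompose'_apply _ _).symm.trans
      (DirectSum.coe_decompose_mul_add_of_right_mem (homogeneousSubmodule (Fin n) K) hf)).trans
      (congrArg (· * f) (decomposition.decompose'_apply b m))
  rw [← h1, map_add, h2, add_sub_cancel_right]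
  exact homogeneousComponent_mem_of_mem hI ha _

lemma isHomogeneous_sup_span {I : Ideal (MvPolynomial (Fin n) K)}
    (hI : I.IsHomogeneous (homogeneousSubmodule (Fin n) K)) {f : MvPolynomial (Fin n) K}
    {e : ℕ} (hf : f.IsHomogeneous e) :
    (I ⊔ Ideal.span {f}).IsHomogeneous (homogeneousSubmodule (Fin n) K) := by
  refine hI.sup (Ideal.homogeneous_span _ _ ?_)
  rintro _ rfl
  exact ⟨e, hf⟩

lemma isHomogeneous_colon {I : Ideal (MvPolynomial (Fin n) K)}
    (hI : I.IsHomogeneous (homogeneousSubmodule (Fin n) K)) {f : MvPolynomial (Fin n) K}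
    {e : ℕ} (hf : f.IsHomogeneous e) :
    (Submodule.colon I {f}).IsHomogeneous (homogeneousSubmodule (Fin n) K) := by
  intro i g hg
  rw [Submodule.mem_colon_singleton, smul_eq_mul] at hg ⊢
  have := hI (i + e) hg
  rwa [DirectSum.coe_decompose_mul_add_of_right_mem (homogeneousSubmodule (Fin n) K) hf] at this

/-- Dimension count in degree `m + e` for the exact sequence `0 → S/(I : f) → S/I → S/(I + (f)) →
0`, whose first map is multiplication by `f` and shifts degrees by `e`. -/
lemma idealHilbertFunction_add {I : Ideal (MvPolynomial (Fin n) K)}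
    (hI : I.IsHomogeneous (homogeneousSubmodule (Fin n) K)) {f : MvPolynomial (Fin n) K}
    {e : ℕ} (hf : f.IsHomogeneous e) (m : ℕ) :
    idealHilbertFunction I (m + e) = idealHilbertFunction (I ⊔ Ideal.span {f}) (m + e) +
      idealHilbertFunction (Submodule.colon I {f}) m := by
  set J := I ⊔ Ideal.span {f} with hJ
  let φ : quotientPart I (m + e) →ₗ[K] MvPolynomial (Fin n) K ⧸ J :=
    (Ideal.Quotient.factorₐ K (le_sup_left : I ≤ J)).toLinearMap.domRestrict _
  let ψ : (MvPolynomial (Fin n) K ⧸ Submodule.colon I {f}) →ₗ[K] MvPolynomial (Fin n) K ⧸ I :=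
    (Submodule.liftQ ((Submodule.colon I {f}).restrictScalars K)
      ((Ideal.Quotient.mkₐ K I).toLinearMap ∘ₗ LinearMap.mulRight K f) (by
        intro g hg
        exact Ideal.Quotient.eq_zero_iff_mem.2 (Submodule.mem_colon_singleton.1 hg)))
  have hψ (g) : ψ (Ideal.Quotient.mk _ g) = Ideal.Quotient.mk I (g * f) := rfl
  have hψinj : Function.Injective ψ := by
    rw [injective_iff_map_eq_zero]
    intro x
    obtain ⟨g, rfl⟩ := Ideal.Quotient.mk_surjective x
    intro h
    rw [hψ, Ideal.Quotient.eq_zero_iff_mem] at h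
    rw [Ideal.Quotient.eq_zero_iff_mem, Submodule.mem_colon_singleton]
    exact h
  have hrange : φ.range = quotientPart J (m + e) := by
    ext x
    simp only [LinearMap.mem_range, Subtype.exists, mem_quotientPart]
    constructor
    · rintro ⟨_, ⟨g, hg, rfl⟩, rfl⟩
      exact ⟨g, hg, rfl⟩
    · rintro ⟨g, hg, rfl⟩
      exact ⟨_, ⟨g, hg, rfl⟩, rfl⟩
  -- Exactness in the middle; homogeneity of `I` ensures that the preimage under multiplication by
  -- `f` can be taken in degree `m`.
  have hker : φ.ker.map (quotientPart I (m + e)).subtype =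
      (quotientPart (Submodule.colon I {f}) m).map ψ := by
    ext x
    simp only [Submodule.mem_map, LinearMap.mem_ker, Subtype.exists, mem_quotientPart]
    constructor
    · rintro ⟨_, ⟨g, hg, rfl⟩, h, rfl⟩
      have hgJ : g ∈ J := Ideal.Quotient.eq_zero_iff_mem.1 h
      obtain ⟨b, hb, hgb⟩ := exists_homogeneous_of_mem_sup_span hI hf hg hgJ
      exact ⟨_, ⟨b, hb, rfl⟩, ((Ideal.Quotient.eq).2 hgb).symm⟩
    · rintro ⟨_, ⟨b, hb, rfl⟩, rfl⟩
      refine ⟨_, ⟨b * f, hb.mul hf, rfl⟩, ?_, rfl⟩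
      refine Ideal.Quotient.eq_zero_iff_mem.2 ?_
      exact Ideal.mul_mem_left _ _ (Ideal.mem_sup_right (Ideal.mem_span_singleton_self f))
  have h1 := LinearMap.finrank_range_add_finrank_ker φ
  have h2 := (Submodule.equivMapOfInjective _ (quotientPart I (m + e)).injective_subtype φ.ker).finrank_eq
  have h3 := (Submodule.equivMapOfInjective ψ hψinj
    (quotientPart (Submodule.colon I {f}) m)).finrank_eq
  rw [hrange] at h1
  rw [hker, ← h3] at h2
  unfold idealHilbertFunction
  omega

lemma idealHilbertFunction_eq_zero {I : Ideal (MvPolynomial (Fin n) K)}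
    (hI : ∀ i, X i ∈ I) {m : ℕ} (hm : 0 < m) : idealHilbertFunction I m = 0 := by
  unfold idealHilbertFunction
  suffices quotientPart I m = ⊥ by rw [this, finrank_bot]
  rw [eq_bot_iff]
  rintro _ ⟨g, hg, rfl⟩
  refine Ideal.Quotient.eq_zero_iff_mem.2 ?_
  have hle : Ideal.span (X '' (Set.univ : Set (Fin n))) ≤ I := by
    rw [Ideal.span_le]
    rintro _ ⟨i, -, rfl⟩
    exact hI i
  refine hle (mem_ideal_span_X_image.2 fun d hd => ?_)
  have hd' : d.degree = m := by
    rw [Finsupp.degree_eq_weight_one]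
    exact hg (mem_support_iff.1 hd)
  by_contra! h
  have : d = 0 := Finsupp.ext fun i => h i (Set.mem_univ i)
  rw [this, map_zero] at hd'
  omega

lemma idealHilbertFunction_pos {I : Ideal (MvPolynomial (Fin n) K)} [I.IsPrime] {i : Fin n}
    (hi : X i ∉ I) (m : ℕ) : 0 < idealHilbertFunction I m := by
  have : Nontrivial (quotientPart I m) := by
    refine ⟨⟨⟨_, X i ^ m, ?_, rfl⟩, 0, ?_⟩⟩
    · simpa using (isHomogeneous_X K i).pow m
    · intro h
      have : Ideal.Quotient.mk I (X i ^ m) = 0 := congrArg Subtype.val h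
      rw [Ideal.Quotient.eq_zero_iff_mem] at this
      exact hi (Ideal.IsPrime.mem_of_pow_mem ‹_› _ this)
  exact Module.finrank_pos

end GradedQuotients

/-! ### Functions that agree with a polynomial at large integers. -/

section EventuallyPolynomial

open Polynomial

/-- The Bernoulli polynomials satisfy `B_{i+1}(x+1) - B_{i+1}(x) = (i+1) x^i`. The case `Q = 0` is
recorded separately because `natDegree 0 = 0` would only give the bound `1`. -/
lemma exists_polynomial_antidifference (Q : ℚ[X]) :
    ∃ R : ℚ[X], taylor 1 R - R = Q ∧ R.natDegree ≤ Q.natDegree + 1 ∧ (Q = 0 → R = 0) := by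
  classical
  refine ⟨∑ i ∈ Q.support, Polynomial.C (Q.coeff i / (i + 1)) * Polynomial.bernoulli (i + 1), ?_, ?_, ?_⟩
  · refine Polynomial.funext fun x => ?_
    rw [eval_sub, taylor_eval, eval_finsetSum, eval_finsetSum, ← Finset.sum_sub_distrib,
      eval_eq_sum, Polynomial.sum]
    refine Finset.sum_congr rfl fun i _ => ?_
    rw [eval_mul, eval_mul, eval_C, eval_C, add_comm x, bernoulli_eval_one_add]
    have : (i + 1 : ℚ) ≠ 0 := by positivity
    push_cast
    field_simp
    ring
  · refine natDegree_sum_le_of_forall_le _ _ fun i hi => ?_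
    refine (natDegree_C_mul_le _ _).trans ?_
    have : (Polynomial.bernoulli (i + 1)).natDegree ≤ i + 1 := by
      rw [Polynomial.bernoulli]
      refine natDegree_sum_le_of_forall_le _ _ fun j hj => ?_
      refine (natDegree_monomial_le _).trans ?_
      omega
    have := le_natDegree_of_mem_supp i hi
    omega
  · rintro rfl
    simp

lemma degree_taylor_sub_lt {R : ℚ[X]} (hR : R ≠ 0) (e : ℚ) :
    (taylor e R - R).degree < R.degree := by
  rw [← degree_taylor R e]
  exact degree_sub_lt_left (degree_taylor R e) (by simpa using hR) (leadingCoeff_taylor e R)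

/-- Hilbert polynomials have no negative leading coefficient, so in a sum of two of them the leading
terms cannot cancel. -/
lemma leadingCoeff_nonneg_of_eventually {P : ℚ[X]} {H : ℕ → ℕ}
    (h : ∀ᶠ m : ℕ in atTop, P.eval (m : ℚ) = H m) : 0 ≤ P.leadingCoeff := by
  by_contra! hlt
  have hpos : ∀ᶠ m : ℕ in atTop, 0 ≤ P.eval (m : ℚ) := h.mono fun m hm => by rw [hm]; positivity
  rcases le_or_gt P.degree 0 with hd | hd
  · obtain ⟨m, hm⟩ := hpos.exists
    rw [eq_C_of_degree_le_zero hd] at hm hlt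
    simp at hm hlt
    exact absurd hm (not_le.2 hlt)
  · have := (P.tendsto_atBot_of_leadingCoeff_nonpos hd hlt.le).comp
      (tendsto_natCast_atTop_atTop (R := ℚ))
    obtain ⟨m, hm1, hm2⟩ := (hpos.and (this.eventually (eventually_lt_atBot 0))).exists
    exact absurd hm1 (not_le.2 hm2)

lemma degree_add_eq_max {P Q : ℚ[X]} (hP : 0 ≤ P.leadingCoeff) (hQ : 0 ≤ Q.leadingCoeff) :
    (P + Q).degree = max P.degree Q.degree := by
  by_cases hP0 : P = 0
  · simp [hP0]
  by_cases hQ0 : Q = 0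
  · simp [hQ0]
  refine degree_add_eq_of_leadingCoeff_add_ne_zero ?_
  have h1 : 0 < P.leadingCoeff := lt_of_le_of_ne hP (Ne.symm (leadingCoeff_ne_zero.2 hP0))
  have h2 : 0 < Q.leadingCoeff := lt_of_le_of_ne hQ (Ne.symm (leadingCoeff_ne_zero.2 hQ0))
  positivity

lemma eq_of_eventually_eval_eq {P Q : ℚ[X]}
    (h : ∀ᶠ m : ℕ in atTop, P.eval (m : ℚ) = Q.eval (m : ℚ)) : P = Q := by
  refine Polynomial.eq_of_infinite_eval_eq P Q ?_
  have := (Nat.frequently_atTop_iff_infinite.1 h.frequently).image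
    (Nat.cast_injective (R := ℚ)).injOn
  exact this.mono (by rintro _ ⟨m, hm, rfl⟩; exact hm)

/-- A function whose first difference is eventually polynomial is eventually polynomial. -/
lemma exists_eventually_polynomial_of_difference {H H' : ℕ → ℕ} {Q : ℚ[X]}
    (hQ : ∀ᶠ m : ℕ in atTop, Q.eval (m : ℚ) = H' m)
    (hH : ∀ m, H (m + 1) = H' (m + 1) + H m) :
    ∃ R : ℚ[X], (∀ᶠ m : ℕ in atTop, R.eval (m : ℚ) = H m) ∧ taylor 1 R - R = taylor 1 Q ∧
      R.natDegree ≤ Q.natDegree + 1 ∧ (Q = 0 → R.natDegree = 0) := by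
  -- The difference `H (m + 1) - H m` is `H'` at `m + 1`, whence the shift of `Q` by one.
  obtain ⟨R, hR, hd, h0⟩ := exists_polynomial_antidifference (taylor 1 Q)
  rw [natDegree_taylor] at hd
  obtain ⟨m₀, hm₀⟩ := eventually_atTop.1 hQ
  -- The added constant makes the two sides agree at `m₀`; equality of differences propagates this
  -- upwards.
  refine ⟨R + Polynomial.C (H m₀ - R.eval (m₀ : ℚ)), ?_, ?_, ?_, ?_⟩
  · refine eventually_atTop.2 ⟨m₀, fun m hm => ?_⟩
    induction m, hm using Nat.le_induction with
    | base => simp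
    | succ m hm ih =>
      have h1 := hm₀ (m + 1) (by omega)
      have h2 := congrArg (eval (m : ℚ)) hR
      simp only [eval_sub, taylor_eval, eval_add, eval_C] at h2 ih ⊢
      rw [hH]
      push_cast at h1 ⊢
      linarith
  · rw [← hR, map_add, taylor_C]
    ring
  · rw [natDegree_add_C]
    exact hd
  · intro hQ0
    rw [h0 (by simp [hQ0])]
    simp

end EventuallyPolynomial

/-! ### Krull dimension of a closed subset through heights in the ambient space. -/

section KrullDimension

open TopologicalSpace Order

variable {T : Type*} [TopologicalSpace T] {Z : Set T}

lemma exists_map_subtype_eq (Y : IrreducibleCloseds T) (hY : (Y : Set T) ⊆ Z) :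
    ∃ Y' : IrreducibleCloseds Z,
      IrreducibleCloseds.map ((↑) : Z → T) continuous_subtype_val Y' = Y := by
  have himage : ((↑) : Z → T) '' (((↑) : Z → T) ⁻¹' (Y : Set T)) = Y := by
    rw [Subtype.image_preimage_coe, Set.inter_eq_right.2 hY]
  refine ⟨⟨((↑) : Z → T) ⁻¹' (Y : Set T), ?_, Y.isClosed.preimage continuous_subtype_val⟩, ?_⟩
  · refine ⟨?_, ?_⟩
    · obtain ⟨y, hy⟩ := Y.isIrreducible.nonempty
      exact ⟨⟨y, hY hy⟩, hy⟩
    · rw [isPreirreducible_iff_isClosed_union_isClosed]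
      rintro z₁ z₂ h₁ h₂ h
      obtain ⟨A, hA, rfl⟩ := isClosed_induced_iff.1 h₁
      obtain ⟨B, hB, rfl⟩ := isClosed_induced_iff.1 h₂
      refine (isPreirreducible_iff_isClosed_union_isClosed.1 Y.isIrreducible.isPreirreducible
        A B hA hB fun y hy => h (a := ⟨y, hY hy⟩) hy).imp ?_ ?_ <;>
      exact fun h x hx => h hx
  · refine IrreducibleCloseds.ext ?_
    rw [IrreducibleCloseds.coe_map]
    change closure (((↑) : Z → T) '' (((↑) : Z → T) ⁻¹' (Y : Set T))) = Y
    rw [himage, Y.isClosed.closure_eq]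

lemma map_subtype_subset (hZ : IsClosed Z) (Y : IrreducibleCloseds Z) :
    (IrreducibleCloseds.map ((↑) : Z → T) continuous_subtype_val Y : Set T) ⊆ Z := by
  rw [IrreducibleCloseds.coe_map]
  exact closure_minimal (by rintro _ ⟨y, -, rfl⟩; exact y.2) hZ

/-- Every irreducible closed set below one contained in `Z` is itself contained in `Z`, so no chain
below it is lost or gained. -/
lemma height_map_subtype (hZ : IsClosed Z) (Y : IrreducibleCloseds Z) :
    height Y = height (IrreducibleCloseds.map ((↑) : Z → T) continuous_subtype_val Y) := by
  have hind : Topology.IsInducing ((↑) : Z → T) := Topology.IsInducing.subtypeVal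
  refine height_eq_of_strictMono _ (IrreducibleCloseds.map_strictMono_of_isInducing hind)
    (fun A B hBA => ?_) Y
  have hBA' : (B : Set T) ⊆ closure (((↑) : Z → T) '' A) := hBA.le
  obtain ⟨A', rfl⟩ := exists_map_subtype_eq B (hBA'.trans (map_subtype_subset hZ A))
  refine ⟨A', lt_of_le_of_ne (fun x hx => ?_) ?_, rfl⟩
  · have hx' : (x : T) ∈ closure (((↑) : Z → T) '' A) :=
      hBA' (subset_closure (Set.mem_image_of_mem _ hx))
    have : x ∈ closure (A : Set Z) := by
      rw [hind.closure_eq_preimage_closure_image]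
      exact hx'
    rwa [A.isClosed.closure_eq] at this
  · rintro rfl
    exact lt_irrefl _ hBA

lemma topologicalKrullDim_eq_iSup_height (hZ : IsClosed Z) :
    topologicalKrullDim Z =
      ⨆ Y : {Y : IrreducibleCloseds T // (Y : Set T) ⊆ Z}, (height Y.1 : WithBot ℕ∞) := by
  rw [topologicalKrullDim, krullDim_eq_iSup_height]
  refine le_antisymm (iSup_le fun Y => ?_) (iSup_le fun ⟨Y, hY⟩ => ?_)
  · rw [height_map_subtype hZ]
    exact le_iSup (fun Y : {Y : IrreducibleCloseds T // (Y : Set T) ⊆ Z} =>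
      (height Y.1 : WithBot ℕ∞)) ⟨_, map_subtype_subset hZ Y⟩
  · obtain ⟨Y', rfl⟩ := exists_map_subtype_eq Y hY
    rw [← height_map_subtype hZ]
    exact le_iSup (fun Y : IrreducibleCloseds Z => (height Y : WithBot ℕ∞)) Y'

/-- The hypothesis at `d = k + 1` bounds all heights by `k`, and at `d = k` it yields a set of
height at least `k`. -/
lemma topologicalKrullDim_eq_of_forall_lt_iff (hZ : IsClosed Z) {k : ℕ}
    (h : ∀ d : ℕ, k < d ↔ ∀ Y : IrreducibleCloseds T, (Y : Set T) ⊆ Z → height Y < d) :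
    topologicalKrullDim Z = k := by
  rw [topologicalKrullDim_eq_iSup_height hZ]
  refine le_antisymm (iSup_le fun ⟨Y, hY⟩ => ?_) ?_
  · have := (h (k + 1)).1 k.lt_succ_self Y hY
    rw [Nat.cast_add, Nat.cast_one] at this
    exact WithBot.coe_le_coe.2 (Order.le_of_lt_add_one this)
  · have := (h k).not.1 (lt_irrefl k)
    push Not at this
    obtain ⟨Y, hY, hk⟩ := this
    refine le_trans (WithBot.coe_le_coe.2 hk) ?_
    exact le_iSup (fun Y : {Y : IrreducibleCloseds T // (Y : Set T) ⊆ Z} =>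
      (height Y.1 : WithBot ℕ∞)) ⟨Y, hY⟩

end KrullDimension

/-! ### The Hilbert polynomial and the dimension of a projective zero locus. -/

section ZeroLoci

open MvPolynomial TopologicalSpace
open Order (height height_mono height_le_coe_iff height_add_one_le)

variable {K : Type*} [Field K] {n : ℕ}

lemma eval_smul_of_isHomogeneous {f : MvPolynomial (Fin n) K} {d : ℕ} (hf : f.IsHomogeneous d)
    (c : K) (v : Fin n → K) : eval (c • v) f = c ^ d * eval v f := by
  rw [eval_eq, eval_eq, Finset.mul_sum]
  refine Finset.sum_congr rfl fun s hs => ?_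
  have hs' : s.degree = d := by
    rw [Finsupp.degree_eq_weight_one]
    exact hf (mem_support_iff.1 hs)
  simp only [Pi.smul_apply, smul_eq_mul, mul_pow, Finset.prod_mul_distrib]
  rw [Finset.prod_pow_eq_pow_sum, ← hs', Finsupp.degree_apply]
  ring

lemma eval_rep_mk_eq_zero_iff {f : MvPolynomial (Fin (n + 1)) K} {d : ℕ} (hf : f.IsHomogeneous d)
    {v : Fin (n + 1) → K} (hv : v ≠ 0) :
    eval (Projectivization.mk K v hv).rep f = 0 ↔ eval v f = 0 := by
  obtain ⟨a, ha⟩ := Projectivization.exists_smul_eq_mk_rep K v hv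
  rw [← ha, Units.smul_def, eval_smul_of_isHomogeneous hf]
  simp

lemma isClosed_iff_exists_zeroLocus {Z : Set (PP K n)} :
    IsClosed Z ↔ ∃ S, HomogeneousSet S ∧ Z = zeroLocus S := by
  rw [← isOpen_compl_iff]
  change Zᶜᶜ ∈ {Z | ∃ S, HomogeneousSet S ∧ Z = zeroLocus S} ↔ _
  rw [compl_compl]
  rfl

variable {I : Ideal (MvPolynomial (Fin (n + 1)) K)}

lemma mem_zeroLocus_of_homogeneous (hI : I.IsHomogeneous (homogeneousSubmodule (Fin (n + 1)) K))
    {v : Fin (n + 1) → K} (h : ∀ f ∈ I, ∀ d, f.IsHomogeneous d → eval v f = 0) :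
    ∀ f ∈ I, eval v f = 0 := by
  intro f hf
  rw [← sum_homogeneousComponent f, map_sum]
  exact Finset.sum_eq_zero fun i _ => h _ (homogeneousComponent_mem_of_mem hI hf i) i
    (homogeneousComponent_isHomogeneous _ _)

lemma isClosed_zeroLocus (hI : I.IsHomogeneous (homogeneousSubmodule (Fin (n + 1)) K)) :
    IsClosed (zeroLocus (I : Set (MvPolynomial (Fin (n + 1)) K))) := by
  refine isClosed_iff_exists_zeroLocus.2 ⟨{f | f ∈ I ∧ ∃ d, f.IsHomogeneous d},
    fun f hf => hf.2, Set.ext fun p => ⟨fun h f hf => h f hf.1, fun h => ?_⟩⟩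
  exact mem_zeroLocus_of_homogeneous hI fun f hf d hd => h f ⟨hf, d, hd⟩

lemma mem_zeroLocus_sup_span {f : MvPolynomial (Fin (n + 1)) K} {p : PP K n}
    (hp : p ∈ zeroLocus (I : Set (MvPolynomial (Fin (n + 1)) K))) (hf : eval p.rep f = 0) :
    p ∈ zeroLocus ((I ⊔ Ideal.span {f} : Ideal _) : Set (MvPolynomial (Fin (n + 1)) K)) := by
  intro g hg
  obtain ⟨a, ha, c, hc, rfl⟩ := Submodule.mem_sup.1 hg
  obtain ⟨b, rfl⟩ := Ideal.mem_span_singleton'.1 hc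
  rw [map_add, hp a ha, map_mul, hf, mul_zero, add_zero]

lemma zeroLocus_anti {S S' : Set (MvPolynomial (Fin (n + 1)) K)} (h : S ⊆ S') :
    zeroLocus S' ⊆ zeroLocus S := fun _ hp f hf => hp f (h hf)

lemma zeroLocus_subset_union (f : MvPolynomial (Fin (n + 1)) K) :
    zeroLocus (I : Set (MvPolynomial (Fin (n + 1)) K)) ⊆
      zeroLocus ((I ⊔ Ideal.span {f} : Ideal _) : Set (MvPolynomial (Fin (n + 1)) K)) ∪
      zeroLocus ((Submodule.colon I {f} : Ideal _) : Set (MvPolynomial (Fin (n + 1)) K)) := by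
  intro p hp
  by_cases hf : eval p.rep f = 0
  · exact Or.inl (mem_zeroLocus_sup_span hp hf)
  · refine Or.inr fun g hg => ?_
    have := hp _ (Submodule.mem_colon_singleton.1 hg)
    rw [smul_eq_mul, map_mul] at this
    exact (mul_eq_zero.1 this).resolve_right hf

lemma le_colon (f : MvPolynomial (Fin (n + 1)) K) : I ≤ Submodule.colon I {f} := fun _ hg =>
  Submodule.mem_colon_singleton.2 (Ideal.mul_mem_right _ _ hg)

lemma colon_eq_of_isPrime [I.IsPrime] {f : MvPolynomial (Fin (n + 1)) K} (hf : f ∉ I) :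
    Submodule.colon I {f} = I :=
  le_antisymm (fun _ hg => ((Ideal.IsPrime.mem_or_mem ‹_›
    (Submodule.mem_colon_singleton.1 hg)).resolve_right hf)) (le_colon f)

lemma lt_sup_span {f : MvPolynomial (Fin (n + 1)) K} (hf : f ∉ I) : I < I ⊔ Ideal.span {f} := by
  refine lt_of_le_of_ne le_sup_left fun h => hf ?_
  rw [h]
  exact Ideal.mem_sup_right (Ideal.mem_span_singleton_self f)

/-- Projective Nullstellensatz for a prime that does not contain all variables. The affine
Nullstellensatz is applied to `X i * f`, which also vanishes at the origin, where the hypothesis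
gives no information on `f`; then `X i` is cancelled. -/
lemma mem_of_forall_zeroLocus [IsAlgClosed K] [I.IsPrime]
    (hI : I.IsHomogeneous (homogeneousSubmodule (Fin (n + 1)) K)) {i : Fin (n + 1)}
    (hi : X i ∉ I) {f : MvPolynomial (Fin (n + 1)) K} {d : ℕ} (hf : f.IsHomogeneous d)
    (h : ∀ p ∈ zeroLocus (I : Set (MvPolynomial (Fin (n + 1)) K)), eval p.rep f = 0) : f ∈ I := by
  suffices X i * f ∈ I from (Ideal.IsPrime.mem_or_mem ‹_› this).resolve_left hi
  have key := vanishingIdeal_zeroLocus_eq_radical (K := K) I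
  rw [Ideal.IsPrime.radical ‹_›] at key
  rw [← key, mem_vanishingIdeal_iff]
  intro x hx
  simp only [mem_zeroLocus_iff, aeval_eq_eval] at hx ⊢
  rw [map_mul, eval_X]
  by_cases hx0 : x = 0
  · simp [hx0]
  · have := h (Projectivization.mk K x hx0) (mem_zeroLocus_of_homogeneous hI fun g hg d hd =>
      (eval_rep_mk_eq_zero_iff hd hx0).2 (hx g hg))
    rw [(eval_rep_mk_eq_zero_iff hf hx0).1 this, mul_zero]

lemma exists_homogeneous_of_not_subset {Z A : Set (PP K n)} (hA : IsClosed A) (h : ¬ Z ⊆ A) :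
    ∃ (f : MvPolynomial (Fin (n + 1)) K) (d : ℕ), f.IsHomogeneous d ∧
      (∀ p ∈ A, eval p.rep f = 0) ∧ ∃ p ∈ Z, eval p.rep f ≠ 0 := by
  obtain ⟨S, hS, rfl⟩ := isClosed_iff_exists_zeroLocus.1 hA
  obtain ⟨p, hpZ, hpA⟩ := Set.not_subset.1 h
  simp only [zeroLocus, Set.mem_ofPred_eq, not_forall] at hpA
  obtain ⟨f, hfS, hf⟩ := hpA
  obtain ⟨d, hd⟩ := hS f hfS
  exact ⟨f, d, hd, fun q hq => hq f hfS, p, hpZ, hf⟩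

lemma isIrreducible_zeroLocus [IsAlgClosed K] [I.IsPrime]
    (hI : I.IsHomogeneous (homogeneousSubmodule (Fin (n + 1)) K)) {i : Fin (n + 1)}
    (hi : X i ∉ I) : IsIrreducible (zeroLocus (I : Set (MvPolynomial (Fin (n + 1)) K))) := by
  constructor
  · by_contra hempty
    rw [Set.not_nonempty_iff_eq_empty] at hempty
    refine Ideal.IsPrime.one_notMem ‹I.IsPrime› ?_
    refine mem_of_forall_zeroLocus hI hi (isHomogeneous_one _ _) ?_
    simp [hempty]
  · rw [isPreirreducible_iff_isClosed_union_isClosed]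
    intro A B hA hB hAB
    by_contra! hcon
    obtain ⟨f, a, hf, hfA, p, hp, hfp⟩ := exists_homogeneous_of_not_subset hA hcon.1
    obtain ⟨g, b, hg, hgB, q, hq, hgq⟩ := exists_homogeneous_of_not_subset hB hcon.2
    have hfg : f * g ∈ I := by
      refine mem_of_forall_zeroLocus hI hi (hf.mul hg) fun x hx => ?_
      rw [map_mul]
      rcases hAB hx with h | h
      · rw [hfA x h, zero_mul]
      · rw [hgB x h, mul_zero]
    rcases Ideal.IsPrime.mem_or_mem ‹_› hfg with h | h
    · exact hfp (hp f h)
    · exact hgq (hq g h)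

/-- `P` is the Hilbert polynomial of the quotient by `I`, and its degree is the dimension of the
projective zero locus of `I`. -/
def IsHilbertPolynomial (I : Ideal (MvPolynomial (Fin (n + 1)) K)) (P : Polynomial ℚ) : Prop :=
  (∀ᶠ m : ℕ in atTop, P.eval (m : ℚ) = idealHilbertFunction I m) ∧
  ∀ d : ℕ, P.degree < d ↔ ∀ Y : IrreducibleCloseds (PP K n),
    (Y : Set (PP K n)) ⊆ zeroLocus (I : Set (MvPolynomial (Fin (n + 1)) K)) → height Y < d

/-- The zero locus is empty, so the height condition is vacuous; it matches `degree 0 = ⊥`, which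
lies below every `d`. This is why `degree` and not `natDegree` is used. -/
lemma isHilbertPolynomial_zero (hI : ∀ i, X i ∈ I) : IsHilbertPolynomial I 0 := by
  refine ⟨?_, fun d => ⟨fun _ Y hY => ?_, fun _ => ?_⟩⟩
  · filter_upwards [eventually_gt_atTop 0] with m hm
    simp [idealHilbertFunction_eq_zero hI hm]
  · obtain ⟨p, hp⟩ := Y.isIrreducible.nonempty
    refine absurd (funext fun i => ?_) p.rep_nonzero
    simpa using hY hp _ (hI i)
  · rw [Polynomial.degree_zero]
    exact WithBot.bot_lt_coe d

/-- Hilbert functions add up to the shift by `e`, and the zero locus is the union of the two smaller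
ones. The degree of the sum is the maximum of the degrees since leading coefficients are
nonnegative, and the dimension of the union is the maximum of the dimensions. -/
lemma IsHilbertPolynomial.of_sup_colon
    (hI : I.IsHomogeneous (homogeneousSubmodule (Fin (n + 1)) K))
    {f : MvPolynomial (Fin (n + 1)) K} {e : ℕ} (hf : f.IsHomogeneous e) {P Q : Polynomial ℚ}
    (hP : IsHilbertPolynomial (I ⊔ Ideal.span {f}) P)
    (hQ : IsHilbertPolynomial (Submodule.colon I {f}) Q) :
    IsHilbertPolynomial I (P + Polynomial.taylor (-e : ℚ) Q) := by
  have hdeg : (P + Polynomial.taylor (-e : ℚ) Q).degree = max P.degree Q.degree := by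
    rw [degree_add_eq_max (leadingCoeff_nonneg_of_eventually hP.1),
      Polynomial.degree_taylor]
    rw [Polynomial.leadingCoeff_taylor]
    exact leadingCoeff_nonneg_of_eventually hQ.1
  refine ⟨?_, fun d => ?_⟩
  · have h1 := (tendsto_sub_atTop_nat e).eventually hQ.1
    filter_upwards [hP.1, h1, eventually_ge_atTop e] with m hm1 hm2 hm3
    obtain ⟨k, rfl⟩ := Nat.exists_eq_add_of_le' hm3
    rw [idealHilbertFunction_add hI hf]
    rw [Nat.add_sub_cancel] at hm2
    rw [Polynomial.eval_add, Polynomial.taylor_eval, hm1, Nat.cast_add k e,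
      add_neg_cancel_right, hm2, Nat.cast_add]
  · rw [hdeg, max_lt_iff, hP.2, hQ.2]
    constructor
    · rintro ⟨h1, h2⟩ Y hY
      rcases isPreirreducible_iff_isClosed_union_isClosed.1 Y.isIrreducible.isPreirreducible _ _
        (isClosed_zeroLocus (isHomogeneous_sup_span hI hf))
        (isClosed_zeroLocus (isHomogeneous_colon hI hf))
        (hY.trans (zeroLocus_subset_union f)) with h | h
      · exact h1 Y h
      · exact h2 Y h
    · intro h
      exact ⟨fun Y hY => h Y (hY.trans (zeroLocus_anti (SetLike.coe_subset_coe.2 le_sup_left))),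
        fun Y hY => h Y (hY.trans (zeroLocus_anti (SetLike.coe_subset_coe.2 (le_colon f))))⟩

/-- For a prime, `I : f = I`, so up to a shift `P` is the difference `Q(x + e) - Q(x)`, in which the
leading terms cancel. -/
lemma IsHilbertPolynomial.degree_lt_of_isPrime [I.IsPrime]
    (hI : I.IsHomogeneous (homogeneousSubmodule (Fin (n + 1)) K))
    {f : MvPolynomial (Fin (n + 1)) K} {e : ℕ} (hf : f.IsHomogeneous e) (hfI : f ∉ I)
    {P Q : Polynomial ℚ} (hQ0 : Q ≠ 0)
    (hP : IsHilbertPolynomial (I ⊔ Ideal.span {f}) P)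
    (hQ : ∀ᶠ m : ℕ in atTop, Q.eval (m : ℚ) = idealHilbertFunction I m) :
    P.degree < Q.degree := by
  have : Polynomial.taylor (e : ℚ) P = Polynomial.taylor (e : ℚ) Q - Q := by
    refine eq_of_eventually_eval_eq ?_
    filter_upwards [hQ, (tendsto_add_atTop_nat e).eventually hQ,
      (tendsto_add_atTop_nat e).eventually hP.1] with m h1 h2 h3
    rw [Polynomial.eval_sub, Polynomial.taylor_eval, Polynomial.taylor_eval]
    rw [Nat.cast_add] at h2 h3
    rw [h1, h2, h3, idealHilbertFunction_add hI hf, colon_eq_of_isPrime hfI]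
    push_cast
    ring
  rw [← Polynomial.degree_taylor P (e : ℚ), this]
  exact degree_taylor_sub_lt hQ0 _

/-- The section by `X i` gives the polynomial `R` through its first difference. Upper bound on
heights: a proper irreducible closed subset lies in the zero locus of some `I + (f)` with `f ∉ I`,
whose Hilbert polynomial has smaller degree. Lower bound: the section by `X i` is a proper subset
and has dimension at least `R.natDegree - 1`. -/
lemma exists_isHilbertPolynomial_of_isPrime [IsAlgClosed K] [I.IsPrime]
    (hI : I.IsHomogeneous (homogeneousSubmodule (Fin (n + 1)) K)) {i : Fin (n + 1)}
    (hi : X i ∉ I)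
    (ih : ∀ J > I, J.IsHomogeneous (homogeneousSubmodule (Fin (n + 1)) K) →
      ∃ P, IsHilbertPolynomial J P) : ∃ P, IsHilbertPolynomial I P := by
  obtain ⟨Q, hQ⟩ := ih _ (lt_sup_span hi) (isHomogeneous_sup_span hI (isHomogeneous_X K i))
  obtain ⟨R, hR, -, hRd, hR0⟩ := exists_eventually_polynomial_of_difference
    (H := idealHilbertFunction I) hQ.1 (fun m => by
      rw [idealHilbertFunction_add hI (isHomogeneous_X K i), colon_eq_of_isPrime hi])
  have hRne : R ≠ 0 := by
    rintro rfl
    obtain ⟨m, hm⟩ := hR.exists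
    have := idealHilbertFunction_pos hi m
    rw [Polynomial.eval_zero] at hm
    exact this.ne (Nat.cast_injective (R := ℚ) (by rw [← hm, Nat.cast_zero]))
  let Z : IrreducibleCloseds (PP K n) := ⟨_, isIrreducible_zeroLocus hI hi, isClosed_zeroLocus hI⟩
  have hZ : (Z : Set (PP K n)) = zeroLocus (I : Set (MvPolynomial (Fin (n + 1)) K)) := rfl
  refine ⟨R, hR, fun d => ?_⟩
  rw [Polynomial.degree_eq_natDegree hRne, Nat.cast_lt]
  constructor
  · intro hd Y hY
    have hYZ : Y ≤ Z := hY
    refine lt_of_le_of_lt (height_mono hYZ) (lt_of_le_of_lt ?_ (Nat.cast_lt.2 hd))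
    rw [height_le_coe_iff]
    intro W hW
    have hWZ : ¬ (Z : Set (PP K n)) ⊆ W := fun h => not_le_of_gt hW h
    obtain ⟨f, e, hf, hfW, p, hp, hfp⟩ := exists_homogeneous_of_not_subset W.isClosed hWZ
    have hfI : f ∉ I := fun h => hfp (hp f h)
    obtain ⟨P, hP⟩ := ih _ (lt_sup_span hfI) (isHomogeneous_sup_span hI hf)
    have hlt := hP.degree_lt_of_isPrime hI hf hfI hRne hR
    rw [Polynomial.degree_eq_natDegree hRne] at hlt
    exact (hP.2 _).1 hlt W fun x hx => mem_zeroLocus_sup_span (hW.le hx) (hfW x hx)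
  · intro h
    have hd := h Z hZ.le
    -- If the section by `X i` has Hilbert polynomial zero, then `R` is constant and only `0 < d` is
    -- needed.
    by_cases hQ0 : Q = 0
    · rw [hR0 hQ0]
      exact Nat.cast_lt.1 (lt_of_le_of_lt (by simp) hd)
    · have hq : ¬ Q.degree < (Q.natDegree : ℕ) := by
        rw [Polynomial.degree_eq_natDegree hQ0]
        exact lt_irrefl _
      rw [hQ.2] at hq
      push Not at hq
      obtain ⟨Y, hY, hYd⟩ := hq
      have hYZ : Y < Z := by
        refine lt_of_le_of_ne (hY.trans (zeroLocus_anti (SetLike.coe_subset_coe.2 le_sup_left))) ?_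
        rintro rfl
        refine hi (mem_of_forall_zeroLocus hI hi (isHomogeneous_X K i) fun p hp => ?_)
        exact hY hp _ (Ideal.mem_sup_right (Ideal.mem_span_singleton_self _))
      have h1 := (add_le_add_left hYd 1).trans (height_add_one_le hYZ)
      have h2 := lt_of_le_of_lt h1 hd
      have h3 : Q.natDegree + 1 < d := by exact_mod_cast h2
      omega

theorem exists_isHilbertPolynomial [IsAlgClosed K] (I : Ideal (MvPolynomial (Fin (n + 1)) K))
    (hI : I.IsHomogeneous (homogeneousSubmodule (Fin (n + 1)) K)) :
    ∃ P, IsHilbertPolynomial I P := by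
  induction I using WellFoundedGT.induction with
  | _ I ih =>
  by_cases hX : ∀ i, X i ∈ I
  · exact ⟨0, isHilbertPolynomial_zero hX⟩
  push Not at hX
  obtain ⟨i, hi⟩ := hX
  by_cases hprime : I.IsPrime
  · exact exists_isHilbertPolynomial_of_isPrime hI hi ih
  have hne : I ≠ ⊤ := fun h => hi (h ▸ Submodule.mem_top)
  -- Primality of a homogeneous ideal can be tested on homogeneous elements. Both `I + (g)` and `I :
  -- g` are then strictly larger than `I`, the latter because it contains `f`.
  have : ∃ f g, f * g ∈ I ∧ f ∉ I ∧ g ∉ I ∧ ∃ e, g.IsHomogeneous e := by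
    by_contra! hcon
    refine hprime (hI.isPrime_of_homogeneous_mem_or_mem hne ?_)
    rintro x y - ⟨e, hy⟩ hxy
    by_contra! hmem
    exact hcon x y hxy hmem.1 hmem.2 e hy
  obtain ⟨f, g, hfg, hf, hg, e, hge⟩ := this
  obtain ⟨P, hP⟩ := ih _ (lt_sup_span hg) (isHomogeneous_sup_span hI hge)
  obtain ⟨Q, hQ⟩ := ih (Submodule.colon I {g})
    (lt_of_le_of_ne (le_colon g) fun h => hf (h ▸ Submodule.mem_colon_singleton.2 hfg))
    (isHomogeneous_colon hI hge)
  exact ⟨_, hP.of_sup_colon hI hge hQ⟩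

end ZeroLoci

/-! ### Spaces of functions on products, and linear independence through minors. -/

section LinearAlgebra

variable {K : Type*} [Field K]

/-- A spanning family contains a linearly independent subfamily of full size. -/
lemma exists_linearIndependent_comp {ι Y W : Type*} [Fintype ι] [AddCommGroup W] [Module K W]
    [FiniteDimensional K W] (φ : Y → W) (hφ : Submodule.span K (Set.range φ) = ⊤)
    (hι : Fintype.card ι = Module.finrank K W) :
    ∃ e : ι → Y, LinearIndependent K (φ ∘ e) := by
  obtain ⟨b, hb, hspan, hli⟩ := exists_linearIndependent K (Set.range φ)
  rw [hφ] at hspan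
  let B : Module.Basis b K W := .mk hli (by rw [Subtype.range_coe, hspan])
  have := Module.Finite.finite_basis B
  have := Fintype.ofFinite b
  have hcard : Fintype.card ι = Fintype.card b := by rw [hι, Module.finrank_eq_card_basis B]
  have e := Fintype.equivOfCardEq hcard
  choose s hs using fun x : b => hb x.2
  refine ⟨s ∘ e, ?_⟩
  have : φ ∘ s ∘ e = ((↑) : b → W) ∘ e := funext fun x => hs _
  rw [this]
  exact hli.comp _ e.injective

lemma linearIndependent_iff_exists_det_ne_zero {ι J : Type*} [Fintype ι] [DecidableEq ι]
    [Fintype J] (M : ι → J → K) :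
    LinearIndependent K M ↔ ∃ e : ι → J, (Matrix.of fun a b => M a (e b)).det ≠ 0 := by
  constructor
  · intro hM
    obtain ⟨e, he⟩ := exists_linearIndependent_comp (K := K) (ι := ι) (fun (j : J) (a : ι) => M a j)
      (by
        -- A functional that kills every column is a linear relation among the rows.
        by_contra hne
        obtain ⟨f, hf0, hf⟩ := Submodule.exists_le_ker_of_lt_top _ (lt_top_iff_ne_top.2 hne)
        refine hf0 (LinearMap.pi_ext' fun a => LinearMap.ext_ring ?_)
        refine Fintype.linearIndependent_iff.1 hM (fun a => f (Pi.single a 1)) ?_ a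
        ext j
        have := hf (Submodule.subset_span ⟨j, rfl⟩)
        rw [LinearMap.mem_ker, LinearMap.pi_apply_eq_sum_univ] at this
        simp only [Finset.sum_apply, Pi.smul_apply, smul_eq_mul, Pi.zero_apply]
        rw [← this]
        refine Finset.sum_congr rfl fun b _ => ?_
        rw [smul_eq_mul, mul_comm]
        congr 2
        ext c
        simp [Pi.single_apply, eq_comm])
      (by simp)
    refine ⟨e, ?_⟩
    rw [← Matrix.det_transpose, ← isUnit_iff_ne_zero, ← Matrix.isUnit_iff_isUnit_det,
      ← Matrix.linearIndependent_rows_iff_isUnit]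
    exact he
  · rintro ⟨e, he⟩
    rw [← isUnit_iff_ne_zero, ← Matrix.isUnit_iff_isUnit_det,
      ← Matrix.linearIndependent_rows_iff_isUnit] at he
    exact LinearIndependent.of_comp (LinearMap.funLeft K K e) he

/-- A finite-dimensional space of functions has a basis which is dual to evaluations at points. -/
lemma exists_dual_points {Y : Type*} (V : Submodule K (Y → K)) [FiniteDimensional K V] :
    ∃ (e : Fin (Module.finrank K V) → Y) (f : Fin (Module.finrank K V) → Y → K),
      Submodule.span K (Set.range f) = V ∧ ∀ a b, f a (e b) = if a = b then 1 else 0 := by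
  let φ : Y → Module.Dual K V := fun y => LinearMap.proj y ∘ₗ V.subtype
  have hφ (y : Y) (v : V) : φ y v = v.1 y := rfl
  have hspan : Submodule.span K (Set.range φ) = ⊤ := by
    by_contra hne
    obtain ⟨f, hf0, hf⟩ := Submodule.exists_le_ker_of_lt_top _ (lt_top_iff_ne_top.2 hne)
    obtain ⟨v, rfl⟩ := (Module.evalEquiv K V).surjective f
    refine hf0 ?_
    have : v = 0 := by
      ext y
      exact hf (Submodule.subset_span ⟨y, rfl⟩)
    rw [this, map_zero]
  obtain ⟨e, he⟩ := exists_linearIndependent_comp (K := K) (ι := Fin (Module.finrank K V)) φ hspan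
    (by simp [Subspace.dual_finrank_eq])
  let B : Module.Basis _ K (Module.Dual K V) := .mk he
    (he.span_eq_top_of_card_eq_finrank' (by simp [Subspace.dual_finrank_eq])).ge
  have hB (b) : B b = φ (e b) := by simp [B]
  -- Evaluations at the points `e b` form a basis of the dual of `V`; its dual basis is carried back
  -- to `V` from the double dual.
  let C := B.dualBasis.map (Module.evalEquiv K V).symm
  refine ⟨e, fun a => (C a : Y → K), ?_, fun a b => ?_⟩
  · have : Set.range (fun a => (C a : Y → K)) = V.subtype '' Set.range C := by
      rw [← Set.range_comp]
      rfl
    rw [this, ← Submodule.map_span, C.span_eq, Submodule.map_subtype_top]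
  · change (C a : Y → K) (e b) = _
    rw [← hφ, ← hB, ← Module.Dual.eval_apply K V, ← Module.evalEquiv_toLinearMap]
    simp only [C, Module.Basis.map_apply, LinearEquiv.coe_coe, LinearEquiv.apply_symm_apply,
      Module.Basis.dualBasis_apply_self]
    simp [eq_comm]

/-- Precomposition of functions with the projection to a factor. -/
def pullback {ι : Type*} {Y : ι → Type*} (i : ι) : (Y i → K) →ₐ[K] ((∀ i, Y i) → K) :=
  AlgHom.pi fun P => Pi.evalAlgHom K _ (P i)

lemma prod_span_range {ι B : Type*} [Fintype ι] [CommSemiring B] [Algebra K B] {J : ι → Type*}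
    (f : ∀ i, J i → B) : ∏ i, Submodule.span K (Set.range (f i)) =
      Submodule.span K (Set.range fun α : ∀ i, J i => ∏ i, f i (α i)) := by
  rw [Submodule.prod_span]
  congr 1
  ext g
  rw [Set.mem_fintype_prod]
  constructor
  · rintro ⟨g, hg, rfl⟩
    choose α ha using hg
    exact ⟨α, Finset.prod_congr rfl fun i _ => ha i⟩
  · rintro ⟨α, rfl⟩
    exact ⟨fun i => f i (α i), fun i => ⟨α i, rfl⟩, rfl⟩

lemma prod_map_pullback_span {ι : Type*} [Fintype ι] {Y : ι → Type*} {J : ι → Type*}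
    (f : ∀ i, J i → Y i → K) :
    ∏ i, (Submodule.span K (Set.range (f i))).map (pullback i : (Y i → K) →ₐ[K] _).toLinearMap =
      Submodule.span K (Set.range fun (α : ∀ i, J i) (P : ∀ i, Y i) => ∏ i, f i (α i) (P i)) := by
  simp only [Submodule.map_span, ← Set.range_comp]
  rw [prod_span_range]
  congr 2
  ext α P
  rw [Finset.prod_apply]
  rfl

/-- Products of basis functions that are dual to points `e i` are independent: evaluation at a tuple
of these points isolates one coefficient. This plays the role of the tensor product of the `V i`. -/
lemma finrank_prod_map_pullback {ι : Type*} [Fintype ι] {Y : ι → Type*}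
    (V : ∀ i, Submodule K (Y i → K)) [∀ i, FiniteDimensional K (V i)] :
    Module.finrank K (∏ i, (V i).map (pullback i : (Y i → K) →ₐ[K] _).toLinearMap :
      Submodule K ((∀ i, Y i) → K)) = ∏ i, Module.finrank K (V i) := by
  classical
  choose e f hf hef using fun i => exists_dual_points (V i)
  have h := prod_map_pullback_span f
  simp only [hf] at h
  rw [h, finrank_span_eq_card]
  · simp
  · rw [Fintype.linearIndependent_iff]
    intro c hc β
    have := congrFun hc fun i => e i (β i)
    simp only [Finset.sum_apply, Pi.smul_apply, hef, smul_eq_mul, Pi.zero_apply] at this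
    rw [Finset.sum_eq_single β] at this
    · simpa using this
    · intro α _ hα
      obtain ⟨i, hi⟩ := Function.ne_iff.1 hα
      rw [Finset.prod_eq_zero (Finset.mem_univ i) (by simp [hi]), mul_zero]
    · simp

/-- The span of the coordinate functions on a family of vectors. -/
def coordinateSpan {Y J : Type*} (w : Y → J → K) : Submodule K (Y → K) :=
  Submodule.span K (Set.range fun j y => w y j)

instance {Y J : Type*} [Finite J] (w : Y → J → K) : FiniteDimensional K (coordinateSpan w) :=
  FiniteDimensional.span_of_finite K (Set.finite_range _)

instance {Y J : Type*} [Finite J] (w : Y → J → K) (m : ℕ) :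
    FiniteDimensional K (coordinateSpan w ^ m : Submodule K (Y → K)) :=
  Module.Finite.iff_fg.2 ((Module.Finite.iff_fg.1 inferInstance).pow m)

lemma finrank_prod_map_pullback_pow {ι J : Type*} [Fintype ι] [Finite J] {Y : ι → Type*}
    (w : ∀ i, Y i → J → K) (m : ℕ) :
    Module.finrank K ((∏ i, (coordinateSpan (w i)).map
      (pullback i : (Y i → K) →ₐ[K] _).toLinearMap) ^ m : Submodule K ((∀ i, Y i) → K)) =
      ∏ i, Module.finrank K (coordinateSpan (w i) ^ m : Submodule K (Y i → K)) := by
  have hpow : (∏ i, (coordinateSpan (w i)).map (pullback i : (Y i → K) →ₐ[K] _).toLinearMap) ^ m =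
      ∏ i, (coordinateSpan (w i) ^ m).map
        (pullback i : (Y i → K) →ₐ[K] ((∀ i, Y i) → K)).toLinearMap := by
    rw [← Finset.prod_pow]
    exact Finset.prod_congr rfl fun i _ => (Submodule.map_pow _ _ m).symm
  rw [hpow, finrank_prod_map_pullback]

/-- Write `w i y` as a combination of the `A i a` with coefficients `u i y a`. The coordinatewise
product then has the Segre monomials `∏ i, u i (P i) (α i)` as coefficients along the independent
products of basis vectors. A left inverse recovers each monomial linearly from the coordinates, and
the monomials span a space that contains the right-hand side. -/
lemma coordinateSpan_prod {ι J : Type*} [Fintype ι] [Fintype J] {Y : ι → Type*}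
    {H : ι → Type*} [∀ i, Fintype (H i)] (w : ∀ i, Y i → J → K) (A : ∀ i, H i → J → K)
    (hA : LinearIndependent K fun (α : ∀ i, H i) (j : J) => ∏ i, A i (α i) j)
    (hw : ∀ i y, w i y ∈ Submodule.span K (Set.range (A i))) :
    coordinateSpan (fun (P : ∀ i, Y i) (j : J) => ∏ i, w i (P i) j) =
      ∏ i, (coordinateSpan (w i)).map (pullback i : (Y i → K) →ₐ[K] _).toLinearMap := by
  classical
  simp only [Submodule.mem_span_range_iff_exists_fun] at hw
  choose u hu using hw
  apply le_antisymm
  · simp only [coordinateSpan]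
    rw [prod_map_pullback_span (fun i j y => w i y j)]
    refine Submodule.span_mono ?_
    rintro _ ⟨j, rfl⟩
    exact ⟨fun _ => j, rfl⟩
  · have hle (i) : coordinateSpan (w i) ≤
        Submodule.span K (Set.range fun (a : H i) (y : Y i) => u i y a) := by
      refine Submodule.span_le.2 ?_
      rintro _ ⟨j, rfl⟩
      refine (Submodule.mem_span_range_iff_exists_fun K).2 ⟨fun a => A i a j, ?_⟩
      ext y
      change _ = w i y j
      rw [← hu i y]
      simp [mul_comm]
    refine (Finset.prod_le_prod' fun i _ => Submodule.map_mono (hle i)).trans ?_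
    rw [prod_map_pullback_span]
    refine Submodule.span_le.2 ?_
    rintro _ ⟨α, rfl⟩
    obtain ⟨g, hg⟩ := LinearMap.exists_leftInverse_of_injective
      (Fintype.linearCombination K fun (α : ∀ i, H i) (j : J) => ∏ i, A i (α i) j)
      (LinearMap.ker_eq_bot.2 hA.fintypeLinearCombination_injective)
    refine (Submodule.mem_span_range_iff_exists_fun K).2
      ⟨fun j => g (Pi.single j 1) α, ?_⟩
    ext P
    have h1 : (fun j => ∏ i, w i (P i) j) = Fintype.linearCombination K
        (fun (α : ∀ i, H i) (j : J) => ∏ i, A i (α i) j) (fun α => ∏ i, u i (P i) (α i)) := by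
      ext j
      simp only [← hu, Finset.sum_apply, Pi.smul_apply, smul_eq_mul,
        Fintype.linearCombination_apply]
      rw [Fintype.prod_sum]
      simp only [Finset.prod_mul_distrib]
    have h2 := congrFun (LinearMap.congr_fun hg fun α => ∏ i, u i (P i) (α i)) α
    rw [LinearMap.comp_apply, ← h1, LinearMap.pi_apply_eq_sum_univ g] at h2
    simp only [Finset.sum_apply, Pi.smul_apply, smul_eq_mul, LinearMap.id_apply] at h2 ⊢
    rw [← h2]
    refine Finset.sum_congr rfl fun j _ => ?_
    have hj : (Pi.single j 1 : J → K) = fun i => if j = i then 1 else 0 := by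
      ext i
      simp [Pi.single_apply, eq_comm]
    rw [mul_comm, hj]

lemma finrank_map_eq_of_forall_eq_zero_iff {V W W' : Type*} [AddCommGroup V] [Module K V]
    [AddCommGroup W] [Module K W] [AddCommGroup W'] [Module K W'] (p : Submodule K V)
    (φ : V →ₗ[K] W) (ψ : V →ₗ[K] W') (h : ∀ x ∈ p, φ x = 0 ↔ ψ x = 0) :
    Module.finrank K (p.map φ) = Module.finrank K (p.map ψ) := by
  have hker : (φ.domRestrict p).ker = (ψ.domRestrict p).ker := by
    ext x
    exact h x x.2
  rw [← LinearMap.range_domRestrict, ← LinearMap.range_domRestrict,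
    ← (φ.domRestrict p).quotKerEquivRange.finrank_eq,
    ← (ψ.domRestrict p).quotKerEquivRange.finrank_eq, hker]

end LinearAlgebra

/-! ### Hilbert functions of projective sets as dimensions of function spaces. -/

section HilbertFunction

open MvPolynomial

variable {K : Type*} [Field K] {n : ℕ}

lemma isHomogeneous_vanishingIdeal (X : Set (PP K n)) :
    (vanishingIdeal X).IsHomogeneous (homogeneousSubmodule (Fin (n + 1)) K) :=
  Ideal.homogeneous_span _ _ fun _ hf => hf.1

lemma eval_rep_eq_zero_of_mem_vanishingIdeal {X : Set (PP K n)} {f : MvPolynomial (Fin (n + 1)) K}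
    (hf : f ∈ vanishingIdeal X) {p : PP K n} (hp : p ∈ X) : eval p.rep f = 0 := by
  have : vanishingIdeal X ≤ RingHom.ker (eval p.rep) := Ideal.span_le.2 fun g hg => hg.2 p hp
  exact this hf

lemma mem_vanishingIdeal_iff {X : Set (PP K n)} {f : MvPolynomial (Fin (n + 1)) K} {d : ℕ}
    (hf : f.IsHomogeneous d) : f ∈ vanishingIdeal X ↔ ∀ p ∈ X, eval p.rep f = 0 :=
  ⟨fun h _ hp => eval_rep_eq_zero_of_mem_vanishingIdeal h hp,
    fun h => Ideal.subset_span ⟨⟨d, hf⟩, h⟩⟩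

lemma zeroLocus_vanishingIdeal {X : Set (PP K n)} (hX : IsClosed X) :
    zeroLocus (vanishingIdeal X : Set (MvPolynomial (Fin (n + 1)) K)) = X := by
  refine Set.Subset.antisymm ?_ fun p hp f hf => eval_rep_eq_zero_of_mem_vanishingIdeal hf hp
  obtain ⟨S, hS, rfl⟩ := isClosed_iff_exists_zeroLocus.1 hX
  exact zeroLocus_anti fun f hf => Ideal.subset_span ⟨hS f hf, fun p hp => hp f hf⟩

lemma hilbertPolynomial_eq {X : Set (PP K n)} {P : Polynomial ℚ}
    (hP : ∀ᶠ m : ℕ in atTop, P.eval (m : ℚ) = hilbertFunction X m) : hilbertPolynomial X = P := by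
  have h : ∃ P : Polynomial ℚ, ∃ m₀ : ℕ, ∀ m ≥ m₀, P.eval (m : ℚ) = (hilbertFunction X m : ℚ) :=
    ⟨P, eventually_atTop.1 hP⟩
  rw [hilbertPolynomial, dif_pos h]
  refine eq_of_eventually_eval_eq ?_
  filter_upwards [eventually_atTop.2 h.choose_spec, hP] with m h1 h2
  rw [h1, h2]

theorem exists_hilbertPolynomial [IsAlgClosed K] {X : Set (PP K n)} (hX : IsClosed X) :
    (∀ᶠ m : ℕ in atTop, (hilbertPolynomial X).eval (m : ℚ) = hilbertFunction X m) ∧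
    (X.Nonempty → hilbertPolynomial X ≠ 0) ∧
    (hilbertPolynomial X ≠ 0 → dim X = (hilbertPolynomial X).natDegree) := by
  obtain ⟨P, hP, hd⟩ := exists_isHilbertPolynomial _ (isHomogeneous_vanishingIdeal X)
  rw [zeroLocus_vanishingIdeal hX] at hd
  rw [hilbertPolynomial_eq hP]
  refine ⟨hP, ?_, fun hP0 => topologicalKrullDim_eq_of_forall_lt_iff hX fun d => ?_⟩
  · rintro ⟨p, hp⟩ rfl
    -- If the polynomial were zero, all heights would be less than `0`; the closure of a point of
    -- `X` contradicts this.
    have h0 := (hd 0).1 (by simp)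
      ⟨closure {p}, isIrreducible_singleton.closure, isClosed_closure⟩
      (closure_minimal (Set.singleton_subset_iff.2 hp) hX)
    simp at h0
  · rw [← hd, Polynomial.degree_eq_natDegree hP0, Nat.cast_lt]

lemma aeval_coordinates_apply {Y J : Type*} (w : Y → J → K) (f : MvPolynomial J K) (y : Y) :
    aeval (fun j y => w y j) f y = eval (w y) f := by
  have : (Pi.evalAlgHom K (fun _ : Y => K) y).comp (aeval fun j y => w y j) = aeval (w y) :=
    algHom_ext fun j => by simp
  rw [← aeval_eq_eval]
  exact DFunLike.congr_fun this f

lemma map_aeval_homogeneousSubmodule {Y J : Type*} (w : Y → J → K) (m : ℕ) :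
    (homogeneousSubmodule J K m).map
      (aeval (fun j y => w y j) : MvPolynomial J K →ₐ[K] (Y → K)).toLinearMap =
      coordinateSpan w ^ m := by
  rw [← homogeneousSubmodule_one_pow, Submodule.map_pow, homogeneousSubmodule_one_eq_span_X,
    Submodule.map_span, ← Set.range_comp, coordinateSpan]
  congr 3
  ext j
  simp

/-- Forms of degree `m` modulo those vanishing on `X` are their restrictions to the vectors `w y`.
Only the vanishing forms have to agree, so the `w y` may represent a dense part of `X` with
repetitions, as the products of points do. -/
lemma hilbertFunction_eq_finrank {X : Set (PP K n)} {Y : Type*} (w : Y → Fin (n + 1) → K) (m : ℕ)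
    (h : ∀ f : MvPolynomial (Fin (n + 1)) K, f.IsHomogeneous m →
      ((∀ p ∈ X, eval p.rep f = 0) ↔ ∀ y, eval (w y) f = 0)) :
    hilbertFunction X m = Module.finrank K (coordinateSpan w ^ m : Submodule K (Y → K)) := by
  rw [← map_aeval_homogeneousSubmodule]
  refine finrank_map_eq_of_forall_eq_zero_iff _ _ _ fun f hf => ?_
  have h1 : Ideal.Quotient.mk (vanishingIdeal X) f = 0 ↔ ∀ p ∈ X, eval p.rep f = 0 := by
    rw [Ideal.Quotient.eq_zero_iff_mem, mem_vanishingIdeal_iff hf]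
  refine h1.trans ((h f hf).trans ?_)
  rw [AlgHom.toLinearMap_apply, funext_iff]
  simp [aeval_coordinates_apply]

lemma forall_closure_eval_rep_eq_zero_iff {Z : Set (PP K n)} {f : MvPolynomial (Fin (n + 1)) K}
    {d : ℕ} (hf : f.IsHomogeneous d) :
    (∀ p ∈ closure Z, eval p.rep f = 0) ↔ ∀ p ∈ Z, eval p.rep f = 0 := by
  refine ⟨fun h p hp => h p (subset_closure hp), fun h p hp => ?_⟩
  have hcl : IsClosed (zeroLocus {f} : Set (PP K n)) :=
    isClosed_iff_exists_zeroLocus.2 ⟨{f}, by rintro _ rfl; exact ⟨d, hf⟩, rfl⟩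
  have : closure Z ⊆ zeroLocus {f} := closure_minimal (by rintro q hq _ rfl; exact h q hq) hcl
  exact this hp f rfl

end HilbertFunction

/-! ### The open set of tuples with independent products of basis vectors. -/

section Generic

open MvPolynomial

variable {K : Type*} [Field K] {n ℓ : ℕ} {h : Fin ℓ → ℕ}

/-- The coordinatewise products of the members of the bases of the linear subspaces. -/
def hadamardFamily (A : ∀ i, Fin (h i + 1) → Fin (n + 1) → K) (α : ∀ i, Fin (h i + 1))
    (j : Fin (n + 1)) : K :=
  ∏ i, A i (α i) j

/-- The tuples of linear subspaces whose Hadamard product has the maximal possible dimension. -/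
def independentSubspaces (K : Type*) [Field K] (n : ℕ) {ℓ : ℕ} (h : Fin ℓ → ℕ) :
    Set (LinearSubspaces K n h) :=
  {L | Module.finrank K (∏ i, (L i).1 : Submodule K (Fin (n + 1) → K)) = ∏ i, (h i + 1)}

/-- The product of the subspaces in the algebra `K^(n+1)` is spanned by the products of basis
vectors, so independence of these does not depend on the bases. -/
lemma mem_independentSubspaces_iff {L : LinearSubspaces K n h}
    {A : ∀ i, Fin (h i + 1) → Fin (n + 1) → K} (hA : IsParameterization A L) :
    L ∈ independentSubspaces K n h ↔ LinearIndependent K (hadamardFamily A) := by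
  have hfam : hadamardFamily A = fun α : ∀ i, Fin (h i + 1) => ∏ i, A i (α i) := by
    ext α j
    rw [Finset.prod_apply]
    rfl
  have hspan : ∏ i, Submodule.span K (Set.range (A i)) = ∏ i, (L i).1 :=
    Finset.prod_congr rfl fun i _ => (hA i).2
  rw [linearIndependent_iff_card_eq_finrank_span, hfam, Set.finrank, ← prod_span_range, hspan]
  simp only [Fintype.card_pi, Fintype.card_fin]
  exact eq_comm

lemma exists_isParameterization (L : LinearSubspaces K n h) :
    ∃ A : ∀ i, Fin (h i + 1) → Fin (n + 1) → K, IsParameterization A L := by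
  have b (i) : Module.Basis (Fin (h i + 1)) K (L i).1 := Module.finBasisOfFinrankEq K _ (L i).2
  refine ⟨fun i a => b i a, fun i => ⟨?_, ?_⟩⟩
  · exact (b i).linearIndependent.map' (L i).1.subtype (Submodule.ker_subtype _)
  · have : Set.range (fun a => (b i a : Fin (n + 1) → K)) = (L i).1.subtype '' Set.range (b i) := by
      rw [← Set.range_comp]
      rfl
    rw [this, ← Submodule.map_span, (b i).span_eq, Submodule.map_subtype_top]

/-- The defining polynomials are the maximal minors of the matrix of products of basis vectors, with
the entries of the parameterizations as variables. -/
lemma isZariskiOpen_independentSubspaces : IsZariskiOpen (independentSubspaces K n h) := by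
  let M (e : (∀ i, Fin (h i + 1)) → Fin (n + 1)) :
      Matrix (∀ i, Fin (h i + 1)) (∀ i, Fin (h i + 1))
        (MvPolynomial (Σ i : Fin ℓ, Fin (h i + 1) × Fin (n + 1)) K) :=
    Matrix.of fun α β => ∏ i, X ⟨i, α i, e β⟩
  refine ⟨Set.range fun e => (M e).det, fun L A hA => ?_⟩
  rw [mem_independentSubspaces_iff hA, linearIndependent_iff_exists_det_ne_zero]
  simp only [Set.exists_range_iff]
  refine exists_congr fun e => ?_
  rw [RingHom.map_det]
  refine not_congr (Eq.congr_left (congrArg Matrix.det ?_))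
  ext α β
  simp [M, hadamardFamily]

lemma nonempty_independentSubspaces (hn : ∏ i, (h i + 1) ≤ n + 1) :
    (independentSubspaces K n h).Nonempty := by
  obtain ⟨s⟩ : Nonempty ((∀ i, Fin (h i + 1)) ↪ Fin (n + 1)) :=
    Function.Embedding.nonempty_of_card_le (by simpa using hn)
  -- Multi-indices are embedded into the coordinates by `s`. With these indicator vectors, the
  -- product indexed by `α` restricts to the unit vector at `α` on the image of `s`.
  let A (i) (a : Fin (h i + 1)) (j : Fin (n + 1)) : K := if ∃ β, s β = j ∧ β i = a then 1 else 0
  have hA (i a β) : A i a (s β) = if β i = a then 1 else 0 := by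
    simp [A]
  have hAi (i) : LinearIndependent K (A i) := by
    -- Coordinates whose multi-index varies only in its `i`-th entry; on them the vectors `A i a`
    -- are unit vectors.
    let t (a : Fin (h i + 1)) : Fin (n + 1) := s (Function.update 0 i a)
    refine LinearIndependent.of_comp (LinearMap.funLeft K K t) ?_
    have : LinearMap.funLeft K K t ∘ A i = fun a => Pi.single a 1 := by
      ext a b
      simp [LinearMap.funLeft_apply, t, hA, Pi.single_apply]
    rw [this]
    exact Pi.linearIndependent_single_one _ _
  let L : LinearSubspaces K n h := fun i => ⟨Submodule.span K (Set.range (A i)), by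
    rw [finrank_span_eq_card (hAi i), Fintype.card_fin]⟩
  refine ⟨L, (mem_independentSubspaces_iff (A := A) fun i => ⟨hAi i, rfl⟩).2 ?_⟩
  refine LinearIndependent.of_comp (LinearMap.funLeft K K s) ?_
  have : LinearMap.funLeft K K s ∘ hadamardFamily A = fun α => Pi.single α 1 := by
    ext α β
    simp [LinearMap.funLeft_apply, hadamardFamily, hA, Pi.single_apply, Finset.prod_ite_zero,
      funext_iff]
  rw [this]
  exact Pi.linearIndependent_single_one _ _

end Generic

/-! ### Hilbert function, dimension and degree of the Hadamard product. -/

section HadamardProduct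

variable {K : Type*} [Field K] {n ℓ : ℕ} {h : Fin ℓ → ℕ}

lemma rep_mem_of_mem_toSet {L : LinearSubspaces K n h} {i : Fin ℓ} {p : PP K n}
    (hp : p ∈ L.toSet i) : p.rep ∈ (L i).1 := by
  refine hp ?_
  rw [Projectivization.submodule_eq]
  exact Submodule.mem_span_singleton_self _

/-- The dimension formula over one-point sets: a zero product would have coordinate span of
dimension `0`, so one factor would have coordinate span `0`, although a representative is never
zero. -/
lemma prod_rep_ne_zero {L : LinearSubspaces K n h} {A : ∀ i, Fin (h i + 1) → Fin (n + 1) → K}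
    (hA : IsParameterization A L) (hLI : LinearIndependent K (hadamardFamily A))
    {P : Fin ℓ → PP K n} (hP : ∀ i, P i ∈ L.toSet i) : (fun j => ∏ i, (P i).rep j) ≠ 0 := by
  intro h0
  have hspan := coordinateSpan_prod (Y := fun _ : Fin ℓ => Unit) (fun i _ => (P i).rep) A hLI
    (fun i _ => by rw [(hA i).2]; exact rep_mem_of_mem_toSet (hP i))
  have hf := finrank_prod_map_pullback (Y := fun _ : Fin ℓ => Unit)
    fun i => coordinateSpan (fun _ : Unit => (P i).rep)
  rw [← hspan] at hf
  have hbot : coordinateSpan (fun (_ : Fin ℓ → Unit) (j : Fin (n + 1)) =>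
      ∏ i, (P i).rep j) = ⊥ := by
    refine Submodule.span_eq_bot.2 ?_
    rintro _ ⟨j, rfl⟩
    exact funext fun _ => congrFun h0 j
  rw [hbot, finrank_bot, eq_comm, Finset.prod_eq_zero_iff] at hf
  obtain ⟨i, -, hi⟩ := hf
  rw [Submodule.finrank_eq_zero] at hi
  refine (P i).rep_nonzero (funext fun j => ?_)
  exact congrFun (Submodule.span_eq_bot.1 hi _ ⟨j, rfl⟩) ()

theorem hilbertFunction_hadamardProduct {L : LinearSubspaces K n h}
    (hL : L ∈ independentSubspaces K n h) {X : Fin ℓ → Set (PP K n)}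
    (hX : ∀ i, X i ⊆ L.toSet i) (m : ℕ) :
    hilbertFunction (hadamardProduct X) m = ∏ i, hilbertFunction (X i) m := by
  obtain ⟨A, hA⟩ := exists_isParameterization L
  have hLI := (mem_independentSubspaces_iff hA).1 hL
  have hne (P : ∀ i, X i) : (fun j => ∏ i, (P i).1.rep j) ≠ 0 :=
    prod_rep_ne_zero hA hLI fun i => hX i (P i).2
  rw [hilbertFunction_eq_finrank (fun (P : ∀ i, X i) j => ∏ i, (P i).1.rep j) m]
  · rw [coordinateSpan_prod (fun i (p : X i) => p.1.rep) A hLI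
      (fun i p => by rw [(hA i).2]; exact rep_mem_of_mem_toSet (hX i p.2)),
      finrank_prod_map_pullback_pow]
    refine Finset.prod_congr rfl fun i _ => ?_
    rw [hilbertFunction_eq_finrank (fun p : X i => p.1.rep) m]
    exact fun f _ => ⟨fun h p => h p p.2, fun h p hp => h ⟨p, hp⟩⟩
  · intro f hf
    rw [hadamardProduct, forall_closure_eval_rep_eq_zero_iff hf]
    constructor
    · intro h P
      rw [← eval_rep_mk_eq_zero_iff hf (hne P)]
      exact h _ ⟨fun i => P i, fun i => (P i).2, hne P, rfl⟩
    · rintro h _ ⟨P, hP, hP0, rfl⟩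
      rw [eval_rep_mk_eq_zero_iff hf]
      exact h fun i => ⟨P i, hP i⟩

theorem dim_degree_hadamardProduct [IsAlgClosed K] {X : Fin ℓ → Set (PP K n)} {r : Fin ℓ → ℕ}
    (hX : ∀ i, IsSubvariety (X i)) (hr : ∀ i, dim (X i) = (r i : WithBot ℕ∞))
    (hH : ∀ m, hilbertFunction (hadamardProduct X) m = ∏ i, hilbertFunction (X i) m) :
    dim (hadamardProduct X) = ((∑ i, r i : ℕ) : WithBot ℕ∞) ∧
      degree (hadamardProduct X) = (Nat.multinomial Finset.univ r : ℚ) * ∏ i, degree (X i) := by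
  have hne (i) : hilbertPolynomial (X i) ≠ 0 :=
    (exists_hilbertPolynomial (hX i).1).2.1 (hX i).2.nonempty
  have hdeg (i) : (hilbertPolynomial (X i)).natDegree = r i := by
    have := (exists_hilbertPolynomial (hX i).1).2.2 (hne i)
    rw [hr i] at this
    exact_mod_cast this.symm
  have hprod : hilbertPolynomial (hadamardProduct X) = ∏ i, hilbertPolynomial (X i) := by
    refine hilbertPolynomial_eq ?_
    filter_upwards [eventually_all.2 fun i => (exists_hilbertPolynomial (hX i).1).1] with m hm
    rw [Polynomial.eval_prod, hH, Nat.cast_prod]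
    exact Finset.prod_congr rfl fun i _ => hm i
  have hprod0 : hilbertPolynomial (hadamardProduct X) ≠ 0 := by
    rw [hprod]
    exact Finset.prod_ne_zero_iff.2 fun i _ => hne i
  have hnat : (hilbertPolynomial (hadamardProduct X)).natDegree = ∑ i, r i := by
    rw [hprod, Polynomial.natDegree_prod _ _ fun i _ => hne i]
    exact Finset.sum_congr rfl fun i _ => hdeg i
  refine ⟨?_, ?_⟩
  · rw [(exists_hilbertPolynomial (X := hadamardProduct X) isClosed_closure).2.2 hprod0, hnat]
  · simp only [degree]
    rw [hnat, hprod, Polynomial.leadingCoeff_prod, Finset.prod_mul_distrib]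
    simp only [hdeg]
    -- The factorial of the sum is the multinomial coefficient times the factorials already
    -- contained in the degrees of the factors.
    rw [← Nat.multinomial_spec Finset.univ r]
    push_cast
    ring

end HadamardProduct

end HadamardVarieties

theorem mainTheorem4 {K : Type*} [Field K] [IsAlgClosed K] [CharZero K]
    (n ℓ : ℕ) (hℓ : 0 < ℓ) (h : Fin ℓ → ℕ) (hn : ∏ i, (h i + 1) ≤ n + 1) :
    HadamardVarieties.ForGenericSubspaces
      (fun L : HadamardVarieties.LinearSubspaces K n h =>
        ∀ (X : Fin ℓ → Set (HadamardVarieties.PP K n)) (r : Fin ℓ → ℕ),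
          (∀ i, HadamardVarieties.IsSubvariety (X i)) →
          (∀ i, X i ⊆ L.toSet i) →
          (∀ i, HadamardVarieties.dim (X i) = (r i : WithBot ℕ∞)) →
            HadamardVarieties.dim (HadamardVarieties.hadamardProduct X)
                = ((∑ i, r i : ℕ) : WithBot ℕ∞) ∧
            HadamardVarieties.degree (HadamardVarieties.hadamardProduct X)
                = (Nat.multinomial Finset.univ r : ℚ) * ∏ i, HadamardVarieties.degree (X i) ∧
            ∀ m : ℕ, HadamardVarieties.hilbertFunction (HadamardVarieties.hadamardProduct X) m
                = ∏ i, HadamardVarieties.hilbertFunction (X i) m) := by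
  refine ⟨_, HadamardVarieties.isZariskiOpen_independentSubspaces,
    HadamardVarieties.nonempty_independentSubspaces hn, fun L hL X r hX hXL hr => ?_⟩
  have hH := HadamardVarieties.hilbertFunction_hadamardProduct hL hXL
  obtain ⟨hdim, hdeg⟩ := HadamardVarieties.dim_degree_hadamardProduct hX hr hH
  exact ⟨hdim, hdeg, hH⟩
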